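/- Let $k\ge 2$. For a finite graph $\Gamma=(V,E)$ and $t\in[0,1]$ let $$P_\Gamma(z,t)=\sum_{\sigma:V\to\{\pm1\}} t^{\#\{\{v,w\}\in E:\ \sigma(v)\neq\sigma(w)\}}\; z^{\#\{v\in V:\ \sigma(v)=-1\}}\qquad(0^0=1),$$ that is, $P_\Gamma(z,t)=\sqrt z^{\,|V|}\sqrt t^{\,|E|}\,Z_\Gamma$, where $Z_\Gamma=\sum_\sigma e^{-H(\sigma)/T}$ is the Ising partition function (free boundary conditions) with $H(\sigma)=-J\sum_{\{v,w\}\in E}\sigma(v)\sigma(w)-h\sum_{v\in V}\sigma(v)$, $z=e^{-2h/T}$, $t=e^{-2J/T}$. As a polynomial in $z$ it has degree $|V|$; its complex zeros $z_1(t),\dots,z_{|V|}(t)$, repeated according to multiplicity, are the Lee–Yang zeros of $\Gamma$ at temperature $t$. For a sequence of finite graphs $\Gamma_n=(V_n,E_n)$, $n\ge 0$, the limiting measure of Lee–Yang zeros at temperature $t$ is the weak limit, as $n\to\infty$, of the probability measures $$\frac1{|V_n|}\sum_{i=1}^{|V_n|}\delta_{z_i(t)},$$ provided that it exists and is supported on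 the unit circle $\{|z|=1\}$. Let $\Gamma^k_0$ be a single vertex (its root), and let $\Gamma^k_{n+1}$ consist of a root joined by an edge to the root of each of $k$ disjoint copies of $\Gamma^k_n$ (the rooted Cayley tree with branching number $k$). Let $\widehat\Gamma^k_0$ be a single vertex, and let $\widehat\Gamma^k_{n+1}$ consist of a central vertex joined by an edge to the root of each of $k+1$ disjoint copies of $\Gamma^k_n$ (the full, or unrooted, Cayley tree). Then for every $t\in[0,1]$ the limiting measures of Lee–Yang zeros $\mu_t$ of $\{\Gamma^k_n\}_{n\ge0}$ and $\widehat\mu_t$ of $\{\widehat\Gamma^k_n\}_{n\ge0}$ exist, and $\widehat\mu_t=\mu_t$. -/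

import Mathlib

open Filter Topology MeasureTheory Polynomial

namespace CayleyIsing

/-! ### The Ising model on a finite graph -/

/-- The Hamiltonian `H(σ) = -J ∑_{ {v,w} ∈ E } σ(v) σ(w) - h ∑_{v ∈ V} σ(v)` of a spin configuration
`σ : V → {±1}` (free boundary conditions); `Sym2.mul` sends the pair `{a, b}` to `a * b`. -/
noncomputable def hamiltonian {V : Type*} [Fintype V] (G : SimpleGraph V) (J h : ℝ)
    (σ : V → ℤˣ) : ℝ :=
  open Classical in
  -J * ∑ e ∈ G.edgeFinset, (((e.map σ).mul : ℤˣ) : ℝ) - h * ∑ v, ((σ v : ℤˣ) : ℝ)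

/-- The partition function `Z(J,h,T) = ∑_σ exp(-H(σ)/T)`. -/
noncomputable def partitionFunction {V : Type*} [Fintype V] (G : SimpleGraph V) (J h T : ℝ) : ℝ :=
  open Classical in
  ∑ σ : V → ℤˣ, Real.exp (-hamiltonian G J h σ / T)

/-- The number of vertices with spin `-1`. -/
noncomputable def numMinus {V : Type*} [Fintype V] (σ : V → ℤˣ) : ℕ :=
  open Classical in
  (Finset.univ.filter fun v => σ v = -1).card

/-- The number of edges whose end points have opposite spins. -/
noncomputable def numDisagree {V : Type*} [Fintype V] (G : SimpleGraph V) (σ : V → ℤˣ) : ℕ :=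
  open Classical in
  (G.edgeFinset.filter fun e => ¬ (e.map σ).IsDiag).card

/-- The partition function at temperature `t` as a polynomial in the field variable `z`, that is
`√z ^ |V| * √t ^ |E| * Z(z,t)` with `z = exp(-2h/T)` and `t = exp(-2J/T)`; see
`eval_partitionPolynomial`. It is also meaningful for `t = 0`. -/
noncomputable def partitionPolynomial {V : Type*} [Fintype V] (G : SimpleGraph V) (t : ℝ) : ℂ[X] :=
  open Classical in
  ∑ σ : V → ℤˣ, C ((t : ℂ) ^ numDisagree G σ) * X ^ numMinus σ

open Classical in
/-- The polynomial is the partition function with the denominators cleared. -/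
theorem eval_partitionPolynomial {V : Type*} [Fintype V] (G : SimpleGraph V) (J h T : ℝ) :
    (partitionPolynomial G (Real.exp (-2 * J / T))).eval ((Real.exp (-2 * h / T) : ℝ) : ℂ) =
      ((√(Real.exp (-2 * h / T)) ^ Fintype.card V *
        √(Real.exp (-2 * J / T)) ^ G.edgeFinset.card * partitionFunction G J h T : ℝ) : ℂ) := by
  have hv : ∀ σ : V → ℤˣ, ∑ v, ((σ v : ℤˣ) : ℝ) = Fintype.card V - 2 * numMinus σ := by
    intro σ
    have h1 : ∀ v, ((σ v : ℤˣ) : ℝ) = 1 - 2 * (if σ v = -1 then 1 else 0) := by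
      intro v
      rcases Int.units_eq_one_or (σ v) with h | h <;> simp [h]
      norm_num
    simp only [h1, Finset.sum_sub_distrib, ← Finset.mul_sum, Finset.sum_boole, numMinus]
    simp
  have he : ∀ σ : V → ℤˣ, ∑ e ∈ G.edgeFinset, (((e.map σ).mul : ℤˣ) : ℝ) =
      G.edgeFinset.card - 2 * numDisagree G σ := by
    intro σ
    have h1 : ∀ e : Sym2 V, (((e.map σ).mul : ℤˣ) : ℝ) =
        1 - 2 * (if ¬ (e.map σ).IsDiag then 1 else 0) := by
      intro e
      induction e with
      | _ a b =>
        rcases Int.units_eq_one_or (σ a) with h | h <;>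
        rcases Int.units_eq_one_or (σ b) with h' | h' <;> simp [h, h'] <;> norm_num
    simp only [h1, Finset.sum_sub_distrib, ← Finset.mul_sum, Finset.sum_boole, numDisagree]
    simp
  have hs : ∀ x : ℝ, √(Real.exp x) = Real.exp (x / 2) := fun x => (Real.exp_half x).symm
  rw [partitionPolynomial, eval_finsetSum, partitionFunction, Finset.mul_sum, Complex.ofReal_sum]
  refine Finset.sum_congr rfl fun σ _ => ?_
  rw [hamiltonian, hv, he, hs, hs]
  simp only [eval_mul, eval_C, eval_pow, eval_X]
  rw [← Complex.ofReal_pow, ← Complex.ofReal_pow, ← Complex.ofReal_mul, Complex.ofReal_inj]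
  simp only [← Real.exp_nat_mul, ← Real.exp_add]
  congr 1
  ring

theorem partitionPolynomial_monic_natDegree {V : Type*} [Fintype V] (G : SimpleGraph V) (t : ℝ) :
    (partitionPolynomial G t).Monic ∧ (partitionPolynomial G t).natDegree = Fintype.card V := by
  classical
  have key : ∀ σ : V → ℤˣ, σ ≠ (fun _ => -1) → numMinus σ < Fintype.card V := by
    intro σ hσ
    refine Finset.card_lt_univ_of_notMem (x := (Function.ne_iff.mp hσ).choose) ?_
    simpa using (Function.ne_iff.mp hσ).choose_spec
  have h1 : numMinus (fun _ : V => (-1 : ℤˣ)) = Fintype.card V := by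
    simp [numMinus, Finset.card_univ]
  have h2 : numDisagree G (fun _ : V => (-1 : ℤˣ)) = 0 := by
    rw [numDisagree, Finset.card_eq_zero, Finset.filter_eq_empty_iff]
    intro e _
    induction e with
    | _ a b => simp
  have hdeg : (∑ σ ∈ Finset.univ.erase (fun _ : V => (-1 : ℤˣ)),
      C ((t : ℂ) ^ numDisagree G σ) * X ^ numMinus σ : ℂ[X]).degree < (Fintype.card V : ℕ) := by
    refine lt_of_le_of_lt (degree_sum_le _ _) ?_
    rw [Finset.sup_lt_iff (WithBot.bot_lt_coe _)]
    intro σ hσ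
    refine lt_of_le_of_lt (degree_C_mul_X_pow_le _ _) ?_
    exact_mod_cast key σ (Finset.ne_of_mem_erase hσ)
  have hp : partitionPolynomial G t = X ^ Fintype.card V +
      ∑ σ ∈ Finset.univ.erase (fun _ : V => (-1 : ℤˣ)),
        C ((t : ℂ) ^ numDisagree G σ) * X ^ numMinus σ := by
    rw [partitionPolynomial, ← Finset.add_sum_erase _ _ (Finset.mem_univ (fun _ : V => (-1 : ℤˣ))),
      h1, h2]
    simp
  rw [hp]
  refine ⟨monic_X_pow_add hdeg, ?_⟩
  rw [natDegree_add_eq_left_of_degree_lt (by rwa [degree_X_pow]), natDegree_X_pow]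

/-- The Lee–Yang zeros at temperature `t`: the complex zeros in `z` of the partition function,
repeated according to multiplicity. -/
noncomputable def leeYangZeros {V : Type*} [Fintype V] (G : SimpleGraph V) (t : ℝ) : Multiset ℂ :=
  (partitionPolynomial G t).roots

theorem card_leeYangZeros {V : Type*} [Fintype V] (G : SimpleGraph V) (t : ℝ) :
    Multiset.card (leeYangZeros G t) = Fintype.card V := by
  rw [leeYangZeros, IsAlgClosed.card_roots_eq_natDegree,
    (partitionPolynomial_monic_natDegree G t).2]

/-- The normalized counting measure `|V|⁻¹ ∑ δ_{z_i(t)}` of the Lee–Yang zeros. -/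
noncomputable def zeroMeasure {V : Type*} [Fintype V] (G : SimpleGraph V) (t : ℝ) : Measure ℂ :=
  (Fintype.card V : ENNReal)⁻¹ • ((leeYangZeros G t).map Measure.dirac).sum

instance {V : Type*} [Fintype V] [Nonempty V] (G : SimpleGraph V) (t : ℝ) :
    IsProbabilityMeasure (zeroMeasure G t) := by
  constructor
  have h : ∀ s : Multiset ℂ, (s.map Measure.dirac).sum Set.univ = (Multiset.card s : ENNReal) := by
    intro s
    induction s using Multiset.induction_on with
    | empty => simp
    | cons a s ih => simp [ih, add_comm]
  rw [zeroMeasure, Measure.smul_apply, h, card_leeYangZeros, smul_eq_mul]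
  exact ENNReal.inv_mul_cancel (by simp) (by simp)

/-! ### Cayley trees -/

/-- A finite graph with a distinguished vertex. -/
structure RootedGraph where
  /-- The vertex set. -/
  V : Type
  [fintype : Fintype V]
  /-- The underlying graph. -/
  graph : SimpleGraph V
  /-- The distinguished vertex. -/
  root : V

attribute [instance] RootedGraph.fintype

instance (Γ : RootedGraph) : Nonempty Γ.V := ⟨Γ.root⟩

/-- A single vertex. -/
def point : RootedGraph where
  V := Unit
  graph := ⊥
  root := ()

/-- The adjacency relation of `graft m Γ`. -/
def graftAdj (m : ℕ) (Γ : RootedGraph) : Option (Fin m × Γ.V) → Option (Fin m × Γ.V) → Prop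
  | none, none => False
  | none, some (_, w) => w = Γ.root
  | some (_, v), none => v = Γ.root
  | some (i, v), some (j, w) => i = j ∧ Γ.graph.Adj v w

/-- Take `m` disjoint copies of `Γ` and a new root (`none`), and join the new root by an edge to the
root of each copy. -/
def graft (m : ℕ) (Γ : RootedGraph) : RootedGraph where
  V := Option (Fin m × Γ.V)
  graph :=
    { Adj := graftAdj m Γ
      symm := by
        constructor
        rintro (_ | ⟨i, v⟩) (_ | ⟨j, w⟩) h
        · exact h
        · exact h
        · exact h
        · exact ⟨h.1.symm, h.2.symm⟩
      loopless := by
        constructor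
        rintro (_ | ⟨i, v⟩) h
        · exact h
        · exact Γ.graph.loopless.irrefl v h.2 }
  root := none

/-- The rooted Cayley tree of level `n` with branching number `k`: every vertex at distance less
than `n` from the root has exactly `k` children. -/
def rootedCayleyTree (k : ℕ) : ℕ → RootedGraph
  | 0 => point
  | n + 1 => graft k (rootedCayleyTree k n)

/-- The full (unrooted) Cayley tree of level `n` with branching number `k`: the ball of radius `n`
in the `(k+1)`-regular tree, namely a central vertex to which `k + 1` copies of the rooted tree of
level `n - 1` are attached. -/
def fullCayleyTree (k : ℕ) : ℕ → RootedGraph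
  | 0 => point
  | n + 1 => graft (k + 1) (rootedCayleyTree k n)

/-! ### Limiting measures of Lee–Yang zeros -/

/-- The measure `μ_{t,n}` of Lee–Yang zeros of a finite graph, as a probability measure on `ℂ`. -/
noncomputable def leeYangMeasure (Γ : RootedGraph) (t : ℝ) : ProbabilityMeasure ℂ :=
  ⟨zeroMeasure Γ.graph t, inferInstance⟩

/-- `μ` is the limiting measure of Lee–Yang zeros of the lattice `Γ` at temperature `t`: it is the
weak limit of the measures of Lee–Yang zeros of the `Γ n`, and it is supported on the unit circle.
(The topology on `ProbabilityMeasure` is that of weak convergence, and it is Hausdorff here, so that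
there is at most one such measure.) -/
def IsLimitingMeasure (Γ : ℕ → RootedGraph) (t : ℝ) (μ : ProbabilityMeasure ℂ) : Prop :=
  Tendsto (fun n => leeYangMeasure (Γ n) t) atTop (𝓝 μ) ∧
    (μ : Measure ℂ) (Metric.sphere (0 : ℂ) 1)ᶜ = 0

end CayleyIsing

namespace CayleyIsing

/-! ### Recursion for the partition polynomials -/

/-! Split the partition polynomial by the spin at the root, `P = P₊ + P₋`. Given the root spin, the
branches are independent, so grafting `m` copies onto a new root gives `P₊' = (P₊ + t P₋) ^ m` and
`P₋' = z (t P₊ + P₋) ^ m` (`rootedPartition_graft`).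

Since `|t a + b| ≤ |a + t b|` whenever `|b| ≤ |a|`, the recursion preserves `|P₋| ≤ |z| |P₊|` in the
disk and the opposite inequality outside it. Hence all zeros lie on the unit circle, and the ratio
`R = P₋ / P₊` is holomorphic in the disk with `|R| ≤ |z|`.

For fixed `z` in the disk, the logarithmic derivative `x n` of `P₊` for the rooted tree of level `n`
satisfies `x (n + 1) = k (x n + e n)`, where `e n` is the logarithmic derivative of `1 + t R`,
bounded uniformly in `n` by Cauchy's estimate. As `k ≥ 2`, `x n / k ^ n` converges geometrically,
and so does `|V n| / k ^ n`, to a nonzero limit. Passing from the rooted to the full tree multiplies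
both numerator and denominator by `k + 1` up to bounded errors (after an index shift), so the
quotients have the same limit (`exists_tendsto_logDeriv_div_card`).

The logarithmic derivative of `P` divided by `|V|` is the Cauchy transform of the measure of zeros.
On the circle these transforms in the disk determine a probability measure, and compactness turns
their convergence into weak convergence. -/

open Classical in
theorem two_mul_numDisagree {V : Type*} [Fintype V] (G : SimpleGraph V) (σ : V → ℤˣ) :
    2 * numDisagree G σ = ∑ v, ∑ w, if G.Adj v w ∧ σ v ≠ σ w then 1 else 0 := by
  -- The disagreeing edges form a subgraph, to which the handshake lemma applies.
  let G' : SimpleGraph V :=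
    { Adj := fun v w => G.Adj v w ∧ σ v ≠ σ w
      symm := ⟨fun v w h => ⟨h.1.symm, h.2.symm⟩⟩
      loopless := ⟨fun v h => h.2 rfl⟩ }
  have h1 : numDisagree G σ = G'.edgeFinset.card := by
    rw [numDisagree]
    congr 1
    ext e
    induction e with
    | _ a b => simp [G']
  rw [h1, ← G'.sum_degrees_eq_twice_card_edges]
  refine Finset.sum_congr rfl fun v _ => ?_
  rw [← G'.card_neighborFinset_eq_degree, Finset.sum_boole, Nat.cast_id]
  congr 1
  ext w
  simp [G']

theorem card_graft (m : ℕ) (Γ : RootedGraph) :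
    Fintype.card (graft m Γ).V = m * Fintype.card Γ.V + 1 := by
  have h := Fintype.card_option (α := Fin m × Γ.V)
  rw [Fintype.card_prod, Fintype.card_fin] at h
  rw [← h]
  exact Fintype.card_congr (Equiv.refl _)

theorem numMinus_graft (m : ℕ) (Γ : RootedGraph) (σ : Option (Fin m × Γ.V) → ℤˣ) :
    numMinus (V := (graft m Γ).V) σ =
      (if σ none = -1 then 1 else 0) + ∑ i, numMinus fun v => σ (some (i, v)) := by
  simp only [numMinus, Finset.card_filter]
  refine Eq.trans (Fintype.sum_option (α := Fin m × Γ.V) _) ?_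
  rw [Fintype.sum_prod_type]

/-- Counting ordered pairs of vertices lets the sum split along `Option (Fin m × Γ.V)`. Each edge at
the new root is then seen twice, once through `w2` and once through `w3`. -/
theorem numDisagree_graft (m : ℕ) (Γ : RootedGraph) (σ : Option (Fin m × Γ.V) → ℤˣ) :
    numDisagree (graft m Γ).graph σ =
      ∑ i, ((if σ none ≠ σ (some (i, Γ.root)) then 1 else 0) +
        numDisagree Γ.graph fun v => σ (some (i, v))) := by
  classical
  let w : Option (Fin m × Γ.V) → Option (Fin m × Γ.V) → ℕ := fun x y =>
    if graftAdj m Γ x y ∧ σ x ≠ σ y then 1 else 0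
  have key : 2 * numDisagree (graft m Γ).graph σ =
      ∑ x : Option (Fin m × Γ.V), ∑ y : Option (Fin m × Γ.V), w x y := by
    refine (two_mul_numDisagree (graft m Γ).graph σ).trans ?_
    refine Finset.sum_congr rfl fun x _ => Finset.sum_congr rfl fun y _ => ?_
    simp only [w]
    congr
  have w1 : w none none = 0 := by simp [w, graftAdj]
  have w2 : ∀ i v, w none (some (i, v)) =
      if v = Γ.root then if σ none ≠ σ (some (i, v)) then 1 else 0 else 0 := by
    intro i v
    rw [← ite_and]
    exact if_congr Iff.rfl rfl rfl
  have w3 : ∀ i v, w (some (i, v)) none =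
      if v = Γ.root then if σ none ≠ σ (some (i, v)) then 1 else 0 else 0 := by
    intro i v
    rw [← ite_and]
    exact if_congr (and_congr Iff.rfl ne_comm) rfl rfl
  have w4 : ∀ i v j u, w (some (i, v)) (some (j, u)) =
      if i = j then if Γ.graph.Adj v u ∧ σ (some (i, v)) ≠ σ (some (j, u)) then 1 else 0
      else 0 := by
    intro i v j u
    rw [← ite_and]
    exact if_congr and_assoc rfl rfl
  have h3 : ∀ (i : Fin m) (v : Γ.V), (∑ j : Fin m, ∑ u, if i = j then
      if Γ.graph.Adj v u ∧ σ (some (i, v)) ≠ σ (some (j, u)) then 1 else 0 else 0)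
      = ∑ u, if Γ.graph.Adj v u ∧ σ (some (i, v)) ≠ σ (some (i, u)) then 1 else 0 := by
    intro i v
    rw [Finset.sum_eq_single i]
    · simp
    · intro j _ hj
      simp [Ne.symm hj]
    · simp
  refine Nat.eq_of_mul_eq_mul_left two_pos ?_
  rw [key, Finset.mul_sum]
  simp only [Fintype.sum_option, Fintype.sum_prod_type, w1, w2, w3, w4, mul_add,
    two_mul_numDisagree, Finset.sum_add_distrib, Finset.sum_ite_eq', Finset.mem_univ, if_true, h3,
    ← Finset.mul_sum]
  ring

/-- The part of the partition polynomial coming from the configurations with spin `s` at the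
root. -/
noncomputable def rootedPartition (Γ : RootedGraph) (t : ℝ) (s : ℤˣ) : ℂ[X] :=
  open Classical in
  ∑ σ : Γ.V → ℤˣ,
    if σ Γ.root = s then C ((t : ℂ) ^ numDisagree Γ.graph σ) * X ^ numMinus σ else 0

theorem sum_intUnits {M : Type*} [AddCommMonoid M] (f : ℤˣ → M) : ∑ s, f s = f 1 + f (-1) := by
  have : (Finset.univ : Finset ℤˣ) = {1, -1} := by decide
  rw [this, Finset.sum_pair (by decide)]

theorem partitionPolynomial_eq_add (Γ : RootedGraph) (t : ℝ) :
    partitionPolynomial Γ.graph t = rootedPartition Γ t 1 + rootedPartition Γ t (-1) := by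
  rw [← sum_intUnits, partitionPolynomial]
  simp only [rootedPartition]
  rw [Finset.sum_comm]
  refine Finset.sum_congr rfl fun σ _ => ?_
  rw [Finset.sum_ite_eq, if_pos (Finset.mem_univ _)]

/-- Once the new root has spin `s`, the `m` copies do not interact. Each contributes the same
factor, in which the edge to the new root costs `t` when the spins differ. -/
theorem rootedPartition_graft (m : ℕ) (Γ : RootedGraph) (t : ℝ) (s : ℤˣ) :
    rootedPartition (graft m Γ) t s = X ^ (if s = -1 then 1 else 0) *
      (∑ s', C ((t : ℂ) ^ (if s ≠ s' then 1 else 0)) * rootedPartition Γ t s') ^ m := by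
  classical
  have h1 : ∑ s', C ((t : ℂ) ^ (if s ≠ s' then 1 else 0)) * rootedPartition Γ t s' =
      ∑ τ : Γ.V → ℤˣ, C ((t : ℂ) ^ ((if s ≠ τ Γ.root then 1 else 0) + numDisagree Γ.graph τ)) *
        X ^ numMinus τ := by
    simp only [rootedPartition, Finset.mul_sum]
    rw [Finset.sum_comm]
    refine Finset.sum_congr rfl fun τ _ => ?_
    simp only [mul_ite, mul_zero, Finset.sum_ite_eq, Finset.mem_univ, if_true, pow_add, C_mul,
      mul_assoc]
  let e : ((graft m Γ).V → ℤˣ) ≃ ℤˣ × (Fin m → Γ.V → ℤˣ) :=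
    { toFun := fun σ => (σ none, fun i v => σ (some (i, v)))
      invFun := fun p o => o.elim p.1 fun q => p.2 q.1 q.2
      left_inv := by
        intro σ
        funext o
        cases o <;> rfl
      right_inv := fun _ => rfl }
  have h2 : rootedPartition (graft m Γ) t s = ∑ p : ℤˣ × (Fin m → Γ.V → ℤˣ),
      if p.1 = s then X ^ (if s = -1 then 1 else 0) *
        ∏ i, (C ((t : ℂ) ^ ((if s ≠ p.2 i Γ.root then 1 else 0) + numDisagree Γ.graph (p.2 i))) *
          X ^ numMinus (p.2 i)) else 0 := by
    rw [rootedPartition]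
    refine Fintype.sum_equiv e _ _ fun σ => ?_
    change (if σ none = s then _ else _) = if σ none = s then _ else _
    by_cases hs : σ none = s
    · rw [if_pos hs, if_pos hs, show numMinus σ = _ from numMinus_graft m Γ σ,
        show numDisagree (graft m Γ).graph σ = _ from numDisagree_graft m Γ σ, hs,
        Finset.prod_mul_distrib, Finset.prod_pow_eq_pow_sum, ← map_prod,
        Finset.prod_pow_eq_pow_sum, pow_add]
      change _ = _ * (C ((t : ℂ) ^ ∑ i, ((if s ≠ σ (some (i, Γ.root)) then 1 else 0) +
        numDisagree Γ.graph fun v => σ (some (i, v)))) *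
          X ^ ∑ i, numMinus fun v => σ (some (i, v)))
      ring
    · rw [if_neg hs, if_neg hs]
  rw [h2, h1, Fintype.sum_prod_type]
  simp only [Finset.sum_ite_irrel, Finset.sum_const_zero, Finset.sum_ite_eq', Finset.mem_univ,
    if_true, ← Finset.mul_sum]
  congr 1
  -- The power of a sum expands into a sum over families of configurations, one for each copy.
  rw [← Fin.prod_const, Finset.prod_univ_sum, Fintype.piFinset_univ]

theorem rootedPartition_graft_one (m : ℕ) (Γ : RootedGraph) (t : ℝ) :
    rootedPartition (graft m Γ) t 1 =
      (rootedPartition Γ t 1 + C (t : ℂ) * rootedPartition Γ t (-1)) ^ m := by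
  rw [rootedPartition_graft, sum_intUnits]
  have : (1 : ℤˣ) ≠ -1 := by decide
  simp [this]

theorem rootedPartition_graft_neg_one (m : ℕ) (Γ : RootedGraph) (t : ℝ) :
    rootedPartition (graft m Γ) t (-1) =
      X * (C (t : ℂ) * rootedPartition Γ t 1 + rootedPartition Γ t (-1)) ^ m := by
  rw [rootedPartition_graft, sum_intUnits]
  have : (-1 : ℤˣ) ≠ 1 := by decide
  simp [this]

theorem rootedPartition_point (t : ℝ) (s : ℤˣ) :
    rootedPartition point t s = X ^ (if s = -1 then 1 else 0) := by
  classical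
  have h0 : ∀ σ : point.V → ℤˣ, numDisagree point.graph σ = 0 := by
    intro σ
    have := two_mul_numDisagree point.graph σ
    simp only [show ∀ v w, ¬ point.graph.Adj v w from fun v w h => h, false_and, if_false,
      Finset.sum_const_zero] at this
    omega
  have h1 : ∀ σ : point.V → ℤˣ, numMinus σ = if σ point.root = -1 then 1 else 0 := by
    intro σ
    simp only [numMinus, Finset.card_filter]
    exact Fintype.sum_unique (ι := Unit) _
  let e : (point.V → ℤˣ) ≃ ℤˣ := Equiv.funUnique Unit ℤˣ
  have he : ∀ σ, e σ = σ point.root := fun _ => rfl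
  simp only [rootedPartition, h0, h1, ← he, pow_zero, map_one, one_mul]
  rw [Equiv.sum_comp e fun s' => if s' = s then (X : ℂ[X]) ^ (if s' = -1 then 1 else 0) else 0,
    Finset.sum_ite_eq', if_pos (Finset.mem_univ _)]

/-! ### The Lee–Yang circle theorem for Cayley trees -/

/-- The difference of the squares is `(1 - t ^ 2) * (‖a‖ ^ 2 - ‖b‖ ^ 2)`, as the cross terms cancel.
-/
theorem norm_mul_add_le_norm_add_mul {t : ℝ} (ht : t ∈ Set.Icc (0 : ℝ) 1) {a b : ℂ}
    (h : ‖b‖ ≤ ‖a‖) : ‖(t : ℂ) * a + b‖ ≤ ‖a + (t : ℂ) * b‖ := by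
  have h2 : ‖b‖ ^ 2 ≤ ‖a‖ ^ 2 := pow_le_pow_left₀ (norm_nonneg _) h 2
  refine (pow_le_pow_iff_left₀ (norm_nonneg _) (norm_nonneg _) two_ne_zero).1 ?_
  simp only [Complex.sq_norm, Complex.normSq_apply, Complex.add_re, Complex.add_im,
    Complex.re_ofReal_mul, Complex.im_ofReal_mul] at h2 ⊢
  have ht2 : 0 ≤ 1 - t ^ 2 := by nlinarith [ht.1, ht.2]
  nlinarith [mul_nonneg ht2 (sub_nonneg.2 h2)]

theorem add_mul_ne_zero_of_norm_lt {t : ℝ} (ht : t ∈ Set.Icc (0 : ℝ) 1) {a b : ℂ}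
    (h : ‖b‖ < ‖a‖) : a + (t : ℂ) * b ≠ 0 := by
  intro h0
  have h1 : a = -((t : ℂ) * b) := eq_neg_of_add_eq_zero_left h0
  have h2 : ‖a‖ = t * ‖b‖ := by
    rw [h1, norm_neg, norm_mul, Complex.norm_real, Real.norm_of_nonneg ht.1]
  nlinarith [ht.1, ht.2, norm_nonneg b]

/-- In the unit disk, the configurations with positive spin at the root dominate. -/
def PlusDominates (Γ : RootedGraph) (t : ℝ) (z : ℂ) : Prop :=
  (rootedPartition Γ t 1).eval z ≠ 0 ∧
    ‖(rootedPartition Γ t (-1)).eval z‖ ≤ ‖z‖ * ‖(rootedPartition Γ t 1).eval z‖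

/-- Outside the unit disk, the configurations with negative spin at the root dominate. -/
def MinusDominates (Γ : RootedGraph) (t : ℝ) (z : ℂ) : Prop :=
  (rootedPartition Γ t (-1)).eval z ≠ 0 ∧
    ‖z‖ * ‖(rootedPartition Γ t 1).eval z‖ ≤ ‖(rootedPartition Γ t (-1)).eval z‖

theorem PlusDominates.norm_lt {Γ : RootedGraph} {t : ℝ} {z : ℂ} (h : PlusDominates Γ t z)
    (hz : ‖z‖ < 1) :
    ‖(rootedPartition Γ t (-1)).eval z‖ < ‖(rootedPartition Γ t 1).eval z‖ :=
  h.2.trans_lt (mul_lt_of_lt_one_left (norm_pos_iff.2 h.1) hz)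

theorem MinusDominates.norm_lt {Γ : RootedGraph} {t : ℝ} {z : ℂ} (h : MinusDominates Γ t z)
    (hz : 1 < ‖z‖) :
    ‖(rootedPartition Γ t 1).eval z‖ < ‖(rootedPartition Γ t (-1)).eval z‖ := by
  have h1 := norm_pos_iff.2 h.1
  have h2 := h.2
  by_contra! h3
  nlinarith

/-- The two `m`-th powers are compared by `norm_mul_add_le_norm_add_mul`; the factor `‖z‖` in the
bound is restored by the spin of the new root itself. -/
theorem PlusDominates.graft {Γ : RootedGraph} {t : ℝ} (ht : t ∈ Set.Icc (0 : ℝ) 1) {z : ℂ}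
    (h : PlusDominates Γ t z) (hz : ‖z‖ < 1) (m : ℕ) : PlusDominates (graft m Γ) t z := by
  have hlt := h.norm_lt hz
  rw [PlusDominates, rootedPartition_graft_one, rootedPartition_graft_neg_one]
  simp only [eval_pow, eval_add, eval_mul, eval_C, eval_X, norm_mul, norm_pow]
  refine ⟨pow_ne_zero _ (add_mul_ne_zero_of_norm_lt ht hlt), ?_⟩
  gcongr
  exact norm_mul_add_le_norm_add_mul ht hlt.le

theorem MinusDominates.graft {Γ : RootedGraph} {t : ℝ} (ht : t ∈ Set.Icc (0 : ℝ) 1) {z : ℂ}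
    (h : MinusDominates Γ t z) (hz : 1 < ‖z‖) (m : ℕ) : MinusDominates (graft m Γ) t z := by
  have hlt := h.norm_lt hz
  rw [MinusDominates, rootedPartition_graft_one, rootedPartition_graft_neg_one]
  simp only [eval_pow, eval_add, eval_mul, eval_C, eval_X, norm_mul, norm_pow]
  refine ⟨mul_ne_zero (norm_pos_iff.1 (zero_lt_one.trans hz)) (pow_ne_zero _ ?_), ?_⟩
  · rw [add_comm]
    exact add_mul_ne_zero_of_norm_lt ht hlt
  · gcongr
    rw [add_comm, add_comm ((t : ℂ) * eval z (rootedPartition Γ t 1))]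
    exact norm_mul_add_le_norm_add_mul ht hlt.le

theorem plusDominates_point (t : ℝ) (z : ℂ) : PlusDominates point t z := by
  have : (1 : ℤˣ) ≠ -1 := by decide
  simp [PlusDominates, rootedPartition_point, this]

theorem minusDominates_point (t : ℝ) {z : ℂ} (hz : z ≠ 0) : MinusDominates point t z := by
  have : (1 : ℤˣ) ≠ -1 := by decide
  simp [MinusDominates, rootedPartition_point, this, hz]

/-- The Lee–Yang property, in the form that is inherited under grafting. -/
def LeeYang (Γ : RootedGraph) (t : ℝ) : Prop :=
  (∀ z : ℂ, ‖z‖ < 1 → PlusDominates Γ t z) ∧ ∀ z : ℂ, 1 < ‖z‖ → MinusDominates Γ t z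

theorem leeYang_point (t : ℝ) : LeeYang point t :=
  ⟨fun z _ => plusDominates_point t z,
    fun _ hz => minusDominates_point t (norm_pos_iff.1 (zero_lt_one.trans hz))⟩

theorem LeeYang.graft {Γ : RootedGraph} {t : ℝ} (ht : t ∈ Set.Icc (0 : ℝ) 1) (h : LeeYang Γ t)
    (m : ℕ) : LeeYang (graft m Γ) t :=
  ⟨fun z hz => (h.1 z hz).graft ht hz m, fun z hz => (h.2 z hz).graft ht hz m⟩

theorem leeYang_rootedCayleyTree (k : ℕ) {t : ℝ} (ht : t ∈ Set.Icc (0 : ℝ) 1) (n : ℕ) :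
    LeeYang (rootedCayleyTree k n) t := by
  induction n with
  | zero => exact leeYang_point t
  | succ n ih => exact ih.graft ht k

theorem leeYang_fullCayleyTree (k : ℕ) {t : ℝ} (ht : t ∈ Set.Icc (0 : ℝ) 1) (n : ℕ) :
    LeeYang (fullCayleyTree k n) t := by
  cases n with
  | zero => exact leeYang_point t
  | succ n => exact (leeYang_rootedCayleyTree k ht n).graft ht (k + 1)

theorem LeeYang.eval_ne_zero {Γ : RootedGraph} {t : ℝ} (h : LeeYang Γ t) {z : ℂ}
    (hz : ‖z‖ ≠ 1) : (partitionPolynomial Γ.graph t).eval z ≠ 0 := by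
  rw [partitionPolynomial_eq_add, eval_add]
  intro h0
  have h1 := congrArg norm (eq_neg_of_add_eq_zero_left h0)
  rw [norm_neg] at h1
  rcases hz.lt_or_gt with hz | hz
  · exact ((h.1 z hz).norm_lt hz).ne h1.symm
  · exact ((h.2 z hz).norm_lt hz).ne h1

theorem LeeYang.norm_eq_one {Γ : RootedGraph} {t : ℝ} (h : LeeYang Γ t) {z : ℂ}
    (hz : z ∈ leeYangZeros Γ.graph t) : ‖z‖ = 1 := by
  by_contra h1
  exact h.eval_ne_zero h1 (isRoot_of_mem_roots hz)

/-! ### Convergence of the logarithmic derivatives in the unit disk -/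

/-- Cauchy's estimate on the circle of radius `(1 - ‖z‖) / 2` about `z` bounds `f'`, and `‖1 + f z‖
≥ 1 - ‖z‖` bounds the denominator. What matters is that the bound depends on `z` alone, hence is
uniform over all trees. -/
theorem norm_logDeriv_one_add_le {f : ℂ → ℂ} (hd : DifferentiableOn ℂ f (Metric.ball 0 1))
    (hf : ∀ w : ℂ, ‖w‖ < 1 → ‖f w‖ ≤ ‖w‖) {z : ℂ} (hz : ‖z‖ < 1) :
    ‖logDeriv (fun w => 1 + f w) z‖ ≤ 2 / (1 - ‖z‖) / (1 - ‖z‖) := by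
  have hr : 0 < 1 - ‖z‖ := sub_pos.2 hz
  have hlt : ∀ w ∈ Metric.closedBall z ((1 - ‖z‖) / 2), ‖w‖ < 1 := by
    intro w hw
    rw [mem_closedBall_iff_norm] at hw
    have := norm_le_norm_add_norm_sub' w z
    linarith
  have h1 : ‖deriv f z‖ ≤ 1 / ((1 - ‖z‖) / 2) := by
    refine Complex.norm_deriv_le_of_forall_mem_sphere_norm_le (half_pos hr) ?_ fun w hw => ?_
    · refine (hd.mono fun w hw => mem_ball_zero_iff.2 (hlt w ?_)).diffContOnCl
      exact Metric.closure_ball_subset_closedBall hw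
    · have := hlt w (Metric.sphere_subset_closedBall hw)
      exact (hf w this).trans this.le
  have h2 : 1 - ‖z‖ ≤ ‖1 + f z‖ := by
    have := norm_sub_norm_le (1 : ℂ) (-f z)
    rw [norm_neg, norm_one, sub_neg_eq_add] at this
    linarith [hf z hz]
  rw [logDeriv_apply, deriv_const_add, norm_div]
  calc ‖deriv f z‖ / ‖1 + f z‖ ≤ (1 / ((1 - ‖z‖) / 2)) / (1 - ‖z‖) := by gcongr
    _ = _ := by rw [one_div_div]

/-- The quotient of the two parts of the partition function. -/
noncomputable def rootRatio (Γ : RootedGraph) (t : ℝ) (z : ℂ) : ℂ :=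
  (rootedPartition Γ t (-1)).eval z / (rootedPartition Γ t 1).eval z

namespace LeeYang

variable {Γ : RootedGraph} {t : ℝ}

theorem norm_rootRatio_le (h : LeeYang Γ t) {z : ℂ} (hz : ‖z‖ < 1) : ‖rootRatio Γ t z‖ ≤ ‖z‖ := by
  have := h.1 z hz
  rw [rootRatio, norm_div, div_le_iff₀ (norm_pos_iff.2 this.1)]
  exact this.2

theorem differentiableOn_rootRatio (h : LeeYang Γ t) :
    DifferentiableOn ℂ (rootRatio Γ t) (Metric.ball 0 1) :=
  (Polynomial.differentiable _).differentiableOn.div (Polynomial.differentiable _).differentiableOn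
    fun z hz => (h.1 z (mem_ball_zero_iff.1 hz)).1

theorem norm_logDeriv_rootRatio_le (h : LeeYang Γ t) {c : ℂ} (hc : ‖c‖ ≤ 1) {z : ℂ}
    (hz : ‖z‖ < 1) :
    ‖logDeriv (fun w => 1 + c * rootRatio Γ t w) z‖ ≤ 2 / (1 - ‖z‖) / (1 - ‖z‖) := by
  refine norm_logDeriv_one_add_le (h.differentiableOn_rootRatio.const_mul c) (fun w hw => ?_) hz
  rw [norm_mul]
  exact (mul_le_of_le_one_left (norm_nonneg _) hc).trans (h.norm_rootRatio_le hw)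

/-- In the disk `P₊ + c P₋ = P₊ (1 + c R)` with both factors nonzero. The case `c = 1` is the whole
partition function, and `c = t` is the base of the power that grafting produces. -/
theorem logDeriv_add_mul (h : LeeYang Γ t) {c : ℂ} (hc : ‖c‖ ≤ 1) {z : ℂ} (hz : ‖z‖ < 1) :
    logDeriv (fun w => (rootedPartition Γ t 1).eval w + c * (rootedPartition Γ t (-1)).eval w) z =
      logDeriv (fun w => (rootedPartition Γ t 1).eval w) z +
        logDeriv (fun w => 1 + c * rootRatio Γ t w) z := by
  have hmem : Metric.ball (0 : ℂ) 1 ∈ 𝓝 z := Metric.isOpen_ball.mem_nhds (mem_ball_zero_iff.2 hz)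
  have heq : (fun w => (rootedPartition Γ t 1).eval w + c * (rootedPartition Γ t (-1)).eval w)
      =ᶠ[𝓝 z] fun w => (rootedPartition Γ t 1).eval w * (1 + c * rootRatio Γ t w) := by
    filter_upwards [hmem] with w hw
    have := (h.1 w (mem_ball_zero_iff.1 hw)).1
    rw [rootRatio]
    field_simp
  have h1 : 1 + c * rootRatio Γ t z ≠ 0 := by
    intro h0
    have h1 := congrArg norm (eq_neg_of_add_eq_zero_left h0)
    rw [norm_neg, norm_mul, norm_one] at h1
    have h2 := mul_le_of_le_one_left (norm_nonneg (rootRatio Γ t z)) hc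
    have h3 := h.norm_rootRatio_le hz
    linarith
  rw [← logDeriv_mul z (h.1 z hz).1 h1 (Polynomial.differentiable _).differentiableAt
    (((h.differentiableOn_rootRatio.differentiableAt hmem).const_mul c).const_add 1),
    logDeriv_apply, logDeriv_apply, heq.deriv_eq, heq.eq_of_nhds]

theorem logDeriv_partitionPolynomial (h : LeeYang Γ t) {z : ℂ} (hz : ‖z‖ < 1) :
    logDeriv (fun w => (partitionPolynomial Γ.graph t).eval w) z =
      logDeriv (fun w => (rootedPartition Γ t 1).eval w) z +
        logDeriv (fun w => 1 + (1 : ℂ) * rootRatio Γ t w) z := by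
  rw [← h.logDeriv_add_mul (by simp) hz, partitionPolynomial_eq_add]
  simp

theorem logDeriv_graft (h : LeeYang Γ t) (ht : t ∈ Set.Icc (0 : ℝ) 1) {z : ℂ} (hz : ‖z‖ < 1)
    (m : ℕ) :
    logDeriv (fun w => (rootedPartition (CayleyIsing.graft m Γ) t 1).eval w) z =
      m * (logDeriv (fun w => (rootedPartition Γ t 1).eval w) z +
        logDeriv (fun w => 1 + (t : ℂ) * rootRatio Γ t w) z) := by
  have hc : ‖(t : ℂ)‖ ≤ 1 := by
    rw [Complex.norm_real, Real.norm_of_nonneg ht.1]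
    exact ht.2
  rw [← h.logDeriv_add_mul hc hz, ← logDeriv_fun_pow, rootedPartition_graft_one]
  · simp
  · exact (Polynomial.differentiable _).differentiableAt.add
      ((Polynomial.differentiable _).differentiableAt.const_mul _)

end LeeYang

/-- Consecutive terms of `x n / k ^ n` differ by `e n / k ^ n`, which is dominated by a geometric
series. -/
theorem exists_tendsto_div_pow {k : ℕ} (hk : 2 ≤ k) {x e : ℕ → ℂ} {C : ℝ}
    (hx : ∀ n, x (n + 1) = k * (x n + e n)) (he : ∀ n, ‖e n‖ ≤ C) :
    ∃ L, Tendsto (fun n => x n / (k : ℂ) ^ n) atTop (𝓝 L) := by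
  have hk0 : (k : ℂ) ≠ 0 := by
    rw [Nat.cast_ne_zero]
    omega
  have hk1 : (1 : ℝ) < k := by exact_mod_cast (show 1 < k by omega)
  refine cauchySeq_tendsto_of_complete
    (cauchySeq_of_le_geometric (k : ℝ)⁻¹ C (inv_lt_one_of_one_lt₀ hk1) fun n => ?_)
  have : x n / (k : ℂ) ^ n - x (n + 1) / (k : ℂ) ^ (n + 1) = -(e n / (k : ℂ) ^ n) := by
    rw [hx, pow_succ]
    field_simp
    ring
  rw [dist_eq_norm, this, norm_neg, norm_div, norm_pow, Complex.norm_natCast, inv_pow,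
    div_eq_mul_inv]
  exact mul_le_mul_of_nonneg_right (he n) (by positivity)

theorem tendsto_bounded_div_pow {k : ℕ} (hk : 2 ≤ k) {e : ℕ → ℂ} {C : ℝ} (he : ∀ n, ‖e n‖ ≤ C) :
    Tendsto (fun n => e n / (k : ℂ) ^ n) atTop (𝓝 0) := by
  have hk1 : (1 : ℝ) < k := by exact_mod_cast (show 1 < k by omega)
  have h := (tendsto_pow_atTop_nhds_zero_of_lt_one (by positivity)
    (inv_lt_one_of_one_lt₀ hk1)).const_mul C
  rw [mul_zero] at h
  refine squeeze_zero_norm (fun n => ?_) h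
  rw [norm_div, norm_pow, Complex.norm_natCast, inv_pow, div_eq_mul_inv]
  exact mul_le_mul_of_nonneg_right (he n) (by positivity)

theorem pow_le_card_rootedCayleyTree (k n : ℕ) :
    k ^ n ≤ Fintype.card (rootedCayleyTree k n).V := by
  induction n with
  | zero => exact Fintype.card_pos
  | succ n ih =>
    rw [rootedCayleyTree, card_graft, pow_succ, mul_comm]
    exact (Nat.mul_le_mul_left k ih).trans (Nat.le_succ _)

theorem exists_tendsto_card_div_pow {k : ℕ} (hk : 2 ≤ k) : ∃ N : ℂ, N ≠ 0 ∧
    Tendsto (fun n => (Fintype.card (rootedCayleyTree k n).V : ℂ) / (k : ℂ) ^ n) atTop (𝓝 N) := by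
  have hk0 : (k : ℂ) ≠ 0 := by
    rw [Nat.cast_ne_zero]
    omega
  -- The recursion `|V (n + 1)| = k |V n| + 1` reads `k (|V n| + 1 / k)`, so the error is the
  -- constant `1 / k`.
  obtain ⟨N, hN⟩ := exists_tendsto_div_pow hk
    (x := fun n => (Fintype.card (rootedCayleyTree k n).V : ℂ)) (e := fun _ => (k : ℂ)⁻¹)
    (fun n => by
      rw [rootedCayleyTree, card_graft]
      push_cast
      field_simp) (fun _ => le_rfl)
  refine ⟨N, ?_, hN⟩
  have h1 : 1 ≤ ‖N‖ := by
    refine ge_of_tendsto' hN.norm fun n => ?_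
    rw [norm_div, norm_pow, Complex.norm_natCast, Complex.norm_natCast,
      one_le_div (by positivity)]
    exact_mod_cast pow_le_card_rootedCayleyTree k n
  exact norm_pos_iff.1 (zero_lt_one.trans_le h1)

/-- The normalized logarithmic derivatives of the partition functions of the rooted and of the
full Cayley trees converge to the same limit in the unit disk. -/
theorem exists_tendsto_logDeriv_div_card {k : ℕ} (hk : 2 ≤ k) {t : ℝ}
    (ht : t ∈ Set.Icc (0 : ℝ) 1) {z : ℂ} (hz : ‖z‖ < 1) : ∃ L : ℂ,
    Tendsto (fun n => logDeriv
      (fun w => (partitionPolynomial (rootedCayleyTree k n).graph t).eval w) z /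
        (Fintype.card (rootedCayleyTree k n).V : ℂ)) atTop (𝓝 L) ∧
    Tendsto (fun n => logDeriv
      (fun w => (partitionPolynomial (fullCayleyTree k n).graph t).eval w) z /
        (Fintype.card (fullCayleyTree k n).V : ℂ)) atTop (𝓝 L) := by
  have hk0 : (k : ℂ) ≠ 0 := by
    rw [Nat.cast_ne_zero]
    omega
  have hk2 : (k : ℂ) + 1 ≠ 0 := by exact_mod_cast (show k + 1 ≠ 0 by omega)
  have hc : ‖(t : ℂ)‖ ≤ 1 := by
    rw [Complex.norm_real, Real.norm_of_nonneg ht.1]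
    exact ht.2
  have hΓ := leeYang_rootedCayleyTree k ht
  have hΓ' := leeYang_fullCayleyTree k ht
  let x : ℕ → ℂ := fun n =>
    logDeriv (fun w => (rootedPartition (rootedCayleyTree k n) t 1).eval w) z
  let e : ℕ → ℂ := fun n =>
    logDeriv (fun w => 1 + (t : ℂ) * rootRatio (rootedCayleyTree k n) t w) z
  let N : ℕ → ℂ := fun n => (Fintype.card (rootedCayleyTree k n).V : ℂ)
  have he := fun n => (hΓ n).norm_logDeriv_rootRatio_le hc hz
  have he1 := fun n => (hΓ n).norm_logDeriv_rootRatio_le (c := 1) (by simp) hz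
  have he2 := fun n => (hΓ' (n + 1)).norm_logDeriv_rootRatio_le (c := 1) (by simp) hz
  obtain ⟨U, hU⟩ := exists_tendsto_div_pow hk (x := x) (e := e)
    (fun n => (hΓ n).logDeriv_graft ht hz k) he
  obtain ⟨M, hM0, hM⟩ := exists_tendsto_card_div_pow hk
  refine ⟨U / M, ?_, ?_⟩
  · have h := (hU.add (tendsto_bounded_div_pow hk he1)).div hM hM0
    rw [add_zero] at h
    refine h.congr fun n => ?_
    rw [(hΓ n).logDeriv_partitionPolynomial hz, Pi.div_apply, ← add_div,
      div_div_div_cancel_right₀ (pow_ne_zero _ hk0)]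
  -- The full tree of level `n + 1` is made of rooted trees of level `n`, so both numerator and
  -- denominator are scaled by `k ^ n`. The common factor `k + 1` cancels in the limit.
  · rw [← tendsto_add_atTop_iff_nat 1]
    have h := (((hU.add (tendsto_bounded_div_pow hk he)).const_mul ((k : ℂ) + 1)).add
      (tendsto_bounded_div_pow hk he2)).div
        ((hM.const_mul ((k : ℂ) + 1)).add (tendsto_bounded_div_pow hk (e := fun _ => 1)
          fun _ => le_rfl)) (by simpa using mul_ne_zero hk2 hM0)
    rw [add_zero, add_zero, add_zero, mul_div_mul_left _ _ hk2] at h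
    refine h.congr fun n => ?_
    have h1 := (hΓ' (n + 1)).logDeriv_partitionPolynomial hz
    have h2 : logDeriv (fun w => (rootedPartition (fullCayleyTree k (n + 1)) t 1).eval w) z =
        ((k + 1 : ℕ) : ℂ) * (x n + e n) := (hΓ n).logDeriv_graft ht hz (k + 1)
    have h3 : (Fintype.card (fullCayleyTree k (n + 1)).V : ℂ) = ((k : ℂ) + 1) * N n + 1 := by
      rw [fullCayleyTree, card_graft]
      push_cast
      rfl
    rw [h1, h2, h3, Pi.div_apply, ← add_div, mul_div_assoc', ← add_div, mul_div_assoc', ← add_div,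
      div_div_div_cancel_right₀ (pow_ne_zero _ hk0)]
    push_cast
    rfl

/-! ### Probability measures on the unit circle and their Cauchy transforms -/

/-- The unit circle. -/
local notation "𝕊" => Metric.sphere (0 : ℂ) 1

open BoundedContinuousFunction in
/-- The inclusion of the unit circle in the complex plane. -/
noncomputable def circleIncl : 𝕊 →ᵇ ℂ := mkOfCompact ⟨Subtype.val, continuous_subtype_val⟩

theorem norm_coe_circle (ζ : 𝕊) : ‖(ζ : ℂ)‖ = 1 := mem_sphere_zero_iff_norm.1 ζ.2

theorem coe_circle_ne_zero (ζ : 𝕊) : (ζ : ℂ) ≠ 0 :=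
  norm_pos_iff.1 (by rw [norm_coe_circle]; exact one_pos)

theorem continuous_zpow_circle (m : ℤ) : Continuous fun ζ : 𝕊 => (ζ : ℂ) ^ m :=
  continuous_subtype_val.zpow₀ m fun ζ => Or.inl (coe_circle_ne_zero ζ)

theorem integrable_of_continuous_circle {f : 𝕊 → ℂ} (hf : Continuous f) (μ : Measure 𝕊)
    [IsFiniteMeasure μ] : Integrable f μ :=
  (BoundedContinuousFunction.mkOfCompact ⟨f, hf⟩).integrable μ

open BoundedContinuousFunction in
/-- A finite measure on the circle is determined by its Fourier coefficients. -/
theorem ext_of_integral_zpow_eq {μ ν : Measure 𝕊} [IsFiniteMeasure μ] [IsFiniteMeasure ν]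
    (h : ∀ m : ℤ, ∫ ζ : 𝕊, (ζ : ℂ) ^ m ∂μ = ∫ ζ : 𝕊, (ζ : ℂ) ^ m ∂ν) : μ = ν := by
  refine ext_of_forall_mem_subalgebra_integral_eq_of_pseudoEMetric_complete_countable (𝕜 := ℂ)
    (A := StarAlgebra.adjoin ℂ {circleIncl}) ?_ fun g hg => ?_
  · intro x y hxy
    refine ⟨fun ζ => (ζ : ℂ), ⟨toContinuousMapStarₐ ℂ circleIncl, ⟨circleIncl,
      StarAlgebra.self_mem_adjoin_singleton ℂ circleIncl, rfl⟩, rfl⟩, fun h => hxy (Subtype.ext h)⟩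
  -- On the circle conjugation is inversion, so products of the coordinate and its conjugate are
  -- integer powers.
  · have hmono : ∀ f ∈ Submonoid.closure ({circleIncl} ∪ star {circleIncl}),
        ∃ m : ℤ, ∀ ζ : 𝕊, f ζ = (ζ : ℂ) ^ m := by
      intro f hf
      induction hf using Submonoid.closure_induction with
      | mem f hf =>
        rcases hf with hf | hf
        · rw [Set.mem_singleton_iff.1 hf]
          exact ⟨1, fun ζ => (zpow_one _).symm⟩
        · rw [Set.star_singleton, Set.mem_singleton_iff] at hf
          refine ⟨-1, fun ζ => ?_⟩
          rw [hf, zpow_neg_one, Complex.inv_eq_conj (norm_coe_circle ζ)]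
          rfl
      | one => exact ⟨0, fun ζ => (zpow_zero _).symm⟩
      | mul f g _ _ hf hg =>
        obtain ⟨a, ha⟩ := hf
        obtain ⟨b, hb⟩ := hg
        refine ⟨a + b, fun ζ => ?_⟩
        rw [BoundedContinuousFunction.mul_apply, ha, hb, zpow_add₀ (coe_circle_ne_zero ζ)]
    have hg' : g ∈ Submodule.span ℂ
        (Submonoid.closure ({circleIncl} ∪ star {circleIncl}) : Set (𝕊 →ᵇ ℂ)) := by
      rw [← StarAlgebra.adjoin_eq_span]
      exact hg
    clear hg
    induction hg' using Submodule.span_induction with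
    | mem f hf =>
      obtain ⟨m, hm⟩ := hmono f hf
      simp only [hm]
      exact h m
    | zero => simp
    | add f g _ _ hf hg =>
      simp only [BoundedContinuousFunction.coe_add, Pi.add_apply]
      rw [integral_add (f.integrable μ) (g.integrable μ),
        integral_add (f.integrable ν) (g.integrable ν), hf, hg]
    | smul a f _ hf =>
      simp only [BoundedContinuousFunction.coe_smul]
      rw [integral_smul, integral_smul, hf]

theorem sub_coe_circle_ne_zero {z : ℂ} (hz : ‖z‖ < 1) (ζ : 𝕊) : z - ζ ≠ 0 := by
  intro h
  rw [sub_eq_zero.1 h, norm_coe_circle] at hz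
  exact lt_irrefl _ hz

theorem continuous_inv_sub_circle {z : ℂ} (hz : ‖z‖ < 1) :
    Continuous fun ζ : 𝕊 => 1 / (z - (ζ : ℂ)) :=
  continuous_const.div (continuous_const.sub continuous_subtype_val) (sub_coe_circle_ne_zero hz)

/-- The Cauchy transform is the generating function of the moments. -/
theorem hasSum_cauchyTransform (μ : Measure 𝕊) [IsProbabilityMeasure μ] {z : ℂ} (hz : ‖z‖ < 1) :
    HasSum (fun n : ℕ => z ^ n * ∫ ζ : 𝕊, (ζ : ℂ) ^ (-(n + 1 : ℤ)) ∂μ)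
      (-∫ ζ : 𝕊, 1 / (z - (ζ : ℂ)) ∂μ) := by
  have hc : ∀ n : ℕ, Continuous fun ζ : 𝕊 => z ^ n * (ζ : ℂ) ^ (-(n + 1 : ℤ)) := fun n =>
    continuous_const.mul (continuous_zpow_circle _)
  have hn : ∀ (n : ℕ) (ζ : 𝕊), ‖z ^ n * (ζ : ℂ) ^ (-(n + 1 : ℤ))‖ = ‖z‖ ^ n := by
    intro n ζ
    rw [norm_mul, norm_pow, norm_zpow, norm_coe_circle, one_zpow, mul_one]
  have h := hasSum_integral_of_summable_integral_norm (μ := μ)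
    (F := fun (n : ℕ) (ζ : 𝕊) => z ^ n * (ζ : ℂ) ^ (-(n + 1 : ℤ)))
    (fun n => integrable_of_continuous_circle (hc n) μ) (by
      simp only [hn, integral_const, probReal_univ, one_smul]
      exact summable_geometric_of_lt_one (norm_nonneg z) hz)
  simp only [integral_const_mul] at h
  -- Pointwise, `-1 / (z - ζ)` is the geometric series with first term `ζ⁻¹` and ratio `z / ζ`.
  suffices hs : -∫ ζ : 𝕊, 1 / (z - (ζ : ℂ)) ∂μ =
      ∫ ζ : 𝕊, ∑' n : ℕ, z ^ n * (ζ : ℂ) ^ (-(n + 1 : ℤ)) ∂μ by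
    rw [hs]
    exact h
  rw [← integral_neg]
  refine integral_congr_ae (Eventually.of_forall fun ζ => ?_)
  have h0 := coe_circle_ne_zero ζ
  have h2 : ‖z / ζ‖ < 1 := by rwa [norm_div, norm_coe_circle, div_one]
  have h3 : ∀ n : ℕ, z ^ n * (ζ : ℂ) ^ (-(n + 1 : ℤ)) = (z / ζ) ^ n * (ζ : ℂ)⁻¹ := by
    intro n
    rw [zpow_neg, zpow_add_one₀ h0, zpow_natCast, div_pow, mul_inv]
    ring
  simp only [h3]
  rw [tsum_mul_right, tsum_geometric_of_norm_lt_one h2, ← mul_inv, sub_mul, one_mul,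
    div_mul_cancel₀ _ h0, ← one_div, ← neg_sub, div_neg, neg_neg]

/-- A probability measure on the circle is determined by its Cauchy transform in the disk. -/
theorem ext_of_cauchyTransform_eq {μ ν : Measure 𝕊} [IsProbabilityMeasure μ]
    [IsProbabilityMeasure ν]
    (h : ∀ z : ℂ, ‖z‖ < 1 → ∫ ζ : 𝕊, 1 / (z - (ζ : ℂ)) ∂μ = ∫ ζ : 𝕊, 1 / (z - (ζ : ℂ)) ∂ν) :
    μ = ν := by
  let c : Measure 𝕊 → ℕ → ℂ := fun μ n => ∫ ζ : 𝕊, (ζ : ℂ) ^ (-(n + 1 : ℤ)) ∂μ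
  have hps : ∀ (μ : Measure 𝕊) [IsProbabilityMeasure μ],
      HasFPowerSeriesAt (fun z => -∫ ζ : 𝕊, 1 / (z - (ζ : ℂ)) ∂μ)
        (FormalMultilinearSeries.ofScalars ℂ (c μ)) 0 := by
    intro μ _
    rw [hasFPowerSeriesAt_iff]
    filter_upwards [Metric.ball_mem_nhds (0 : ℂ) one_pos] with z hz
    rw [zero_add]
    simp only [FormalMultilinearSeries.coeff_ofScalars, smul_eq_mul]
    exact hasSum_cauchyTransform μ (mem_ball_zero_iff.1 hz)
  have heq : (fun z : ℂ => -∫ ζ : 𝕊, 1 / (z - (ζ : ℂ)) ∂μ) =ᶠ[𝓝 0]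
      fun z => -∫ ζ : 𝕊, 1 / (z - (ζ : ℂ)) ∂ν := by
    filter_upwards [Metric.ball_mem_nhds (0 : ℂ) one_pos] with z hz
    rw [h z (mem_ball_zero_iff.1 hz)]
  have hcoef : ∀ n, c μ n = c ν n := by
    intro n
    have := congrArg (fun p => FormalMultilinearSeries.coeff p n)
      (((hps μ).congr heq).eq_formalMultilinearSeries (hps ν))
    simpa using this
  refine ext_of_integral_zpow_eq fun m => ?_
  -- The Taylor coefficients give only the moments of negative order. Those of positive order are
  -- their conjugates, and the moment of order `0` is the total mass `1`.
  obtain ⟨n, rfl | rfl⟩ := m.eq_nat_or_neg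
  · rcases n with _ | n
    · simp
    · have h1 : ∀ ζ : 𝕊, (ζ : ℂ) ^ ((n + 1 : ℕ) : ℤ) =
          (starRingEnd ℂ) ((ζ : ℂ) ^ (-(n + 1 : ℤ))) := by
        intro ζ
        rw [map_zpow₀, ← Complex.inv_eq_conj (norm_coe_circle ζ), inv_zpow, zpow_neg, inv_inv]
        rfl
      simp only [h1]
      rw [integral_conj, integral_conj]
      exact congrArg _ (hcoef n)
  · rcases n with _ | n
    · simp
    · exact_mod_cast hcoef n

/-- If the Cauchy transforms of a sequence of probability measures on the circle converge in the
disk, then the sequence converges weakly, and the limits of the Cauchy transforms are those of the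
limit. -/
theorem exists_tendsto_of_cauchyTransform {ν : ℕ → ProbabilityMeasure 𝕊} {L : ℂ → ℂ}
    (h : ∀ z : ℂ, ‖z‖ < 1 →
      Tendsto (fun n => ∫ ζ : 𝕊, 1 / (z - (ζ : ℂ)) ∂(ν n : Measure 𝕊)) atTop (𝓝 (L z))) :
    ∃ μ : ProbabilityMeasure 𝕊, Tendsto ν atTop (𝓝 μ) ∧
      ∀ z : ℂ, ‖z‖ < 1 → ∫ ζ : 𝕊, 1 / (z - (ζ : ℂ)) ∂(μ : Measure 𝕊) = L z := by
  -- The kernel `1 / (z - ζ)` is continuous and bounded on the circle, so weak convergence along an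
  -- ultrafilter carries the transforms to the limit.
  have hcluster : ∀ μ, MapClusterPt μ atTop ν →
      ∀ z : ℂ, ‖z‖ < 1 → ∫ ζ : 𝕊, 1 / (z - (ζ : ℂ)) ∂(μ : Measure 𝕊) = L z := by
    intro μ hμ z hz
    obtain ⟨U, hU, hU'⟩ := mapClusterPt_iff_ultrafilter.1 hμ
    have h1 := (ProbabilityMeasure.tendsto_iff_forall_integral_rclike_tendsto ℂ).1 hU'
      (BoundedContinuousFunction.mkOfCompact ⟨_, continuous_inv_sub_circle hz⟩)
    exact tendsto_nhds_unique h1 ((h z hz).mono_left hU)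
  -- The probability measures on the compact circle form a compact space, where a sequence with a
  -- unique cluster point converges.
  obtain ⟨μ, hμ⟩ := exists_clusterPt_of_compactSpace (map ν atTop)
  refine ⟨μ, tendsto_nhds_of_unique_mapClusterPt fun μ' hμ' => ?_, hcluster μ hμ⟩
  refine Subtype.ext (ext_of_cauchyTransform_eq (μ := (μ' : Measure 𝕊))
    (ν := (μ : Measure 𝕊)) fun z hz => ?_)
  exact (hcluster μ' hμ' z hz).trans (hcluster μ hμ z hz).symm

/-! ### The measures of Lee–Yang zeros -/

theorem integral_sum_dirac (s : Multiset ℂ) (f : ℂ → ℂ) :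
    Integrable f (s.map Measure.dirac).sum ∧
      ∫ x, f x ∂(s.map Measure.dirac).sum = (s.map f).sum := by
  induction s using Multiset.induction_on with
  | empty => simp
  | cons a s ih =>
    have ha : Integrable f (Measure.dirac a) := integrable_dirac (by simp)
    rw [Multiset.map_cons, Multiset.sum_cons, Multiset.map_cons, Multiset.sum_cons]
    refine ⟨ha.add_measure ih.1, ?_⟩
    rw [integral_add_measure ha ih.1, ih.2, integral_dirac]

theorem integral_zeroMeasure {V : Type*} [Fintype V] (G : SimpleGraph V) (t : ℝ) (f : ℂ → ℂ) :
    ∫ x, f x ∂(zeroMeasure G t) = ((leeYangZeros G t).map f).sum / (Fintype.card V : ℂ) := by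
  rw [zeroMeasure, integral_smul_measure, (integral_sum_dirac _ f).2, div_eq_inv_mul]
  simp

/-- The logarithmic derivative of a polynomial is the sum of `1 / (z - zᵢ)` over its roots; this
links the recursion to the measures. -/
theorem integral_inv_sub_zeroMeasure {V : Type*} [Fintype V] (G : SimpleGraph V) (t : ℝ) {z : ℂ}
    (hz : (partitionPolynomial G t).eval z ≠ 0) :
    ∫ x, 1 / (z - x) ∂(zeroMeasure G t) =
      logDeriv (fun w => (partitionPolynomial G t).eval w) z / (Fintype.card V : ℂ) := by
  rw [integral_zeroMeasure, logDeriv_apply, Polynomial.deriv, leeYangZeros,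
    (IsAlgClosed.splits _).eval_derivative_div_eval_of_ne_zero hz]

theorem LeeYang.zeroMeasure_compl {Γ : RootedGraph} {t : ℝ} (h : LeeYang Γ t) :
    zeroMeasure Γ.graph t 𝕊ᶜ = 0 := by
  have key : ∀ s : Multiset ℂ, (∀ z ∈ s, ‖z‖ = 1) → (s.map Measure.dirac).sum 𝕊ᶜ = 0 := by
    intro s hs
    induction s using Multiset.induction_on with
    | empty => simp
    | cons a s ih =>
      have h1 : a ∉ 𝕊ᶜ := by
        simpa using hs a (Multiset.mem_cons_self a s)
      rw [Multiset.map_cons, Multiset.sum_cons, Measure.add_apply,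
        ih fun z hz => hs z (Multiset.mem_cons_of_mem hz),
        Measure.dirac_apply' a Metric.isClosed_sphere.measurableSet.compl,
        Set.indicator_of_notMem h1, add_zero]
  rw [zeroMeasure, Measure.smul_apply, key _ fun z hz => h.norm_eq_one hz, smul_zero]

/-- The measure of Lee–Yang zeros as a measure on the circle. -/
theorem LeeYang.exists_circleMeasure {Γ : RootedGraph} {t : ℝ} (h : LeeYang Γ t) :
    ∃ ν : ProbabilityMeasure 𝕊,
      leeYangMeasure Γ t = ν.map continuous_subtype_val.measurable.aemeasurable ∧
      ∀ z : ℂ, ‖z‖ < 1 → ∫ ζ : 𝕊, 1 / (z - (ζ : ℂ)) ∂(ν : Measure 𝕊) =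
        logDeriv (fun w => (partitionPolynomial Γ.graph t).eval w) z /
          (Fintype.card Γ.V : ℂ) := by
  have he : MeasurableEmbedding (Subtype.val : 𝕊 → ℂ) :=
    MeasurableEmbedding.subtype_coe Metric.isClosed_sphere.measurableSet
  have hmap : ((zeroMeasure Γ.graph t).comap (Subtype.val : 𝕊 → ℂ)).map Subtype.val =
      zeroMeasure Γ.graph t := by
    rw [he.map_comap, Subtype.range_coe, Measure.restrict_eq_self_of_ae_mem]
    exact h.zeroMeasure_compl
  have hprob : IsProbabilityMeasure ((zeroMeasure Γ.graph t).comap (Subtype.val : 𝕊 → ℂ)) := by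
    constructor
    rw [← Set.preimage_univ (f := (Subtype.val : 𝕊 → ℂ)), ← he.map_apply, hmap, measure_univ]
  refine ⟨⟨_, hprob⟩, Subtype.ext hmap.symm, fun z hz => ?_⟩
  rw [← integral_inv_sub_zeroMeasure _ _ (h.eval_ne_zero hz.ne)]
  conv_rhs => rw [← hmap]
  exact (he.integral_map fun x : ℂ => 1 / (z - x)).symm

theorem isLimitingMeasure_map {Γ : ℕ → RootedGraph} {t : ℝ} {ν : ℕ → ProbabilityMeasure 𝕊}
    (hν : ∀ n, leeYangMeasure (Γ n) t =
      (ν n).map continuous_subtype_val.measurable.aemeasurable)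
    {μ : ProbabilityMeasure 𝕊} (hμ : Tendsto ν atTop (𝓝 μ)) :
    IsLimitingMeasure Γ t (μ.map continuous_subtype_val.measurable.aemeasurable) := by
  refine ⟨?_, ?_⟩
  · simp only [hν]
    exact ProbabilityMeasure.tendsto_map_of_tendsto_of_continuous ν μ hμ continuous_subtype_val
  · rw [ProbabilityMeasure.toMeasure_map,
      Measure.map_apply measurable_subtype_coe Metric.isClosed_sphere.measurableSet.compl]
    simp

end CayleyIsing

open CayleyIsing in
theorem proposition5p2 (k : ℕ) (hk : 2 ≤ k) (t : ℝ) (ht : t ∈ Set.Icc (0 : ℝ) 1) :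
    ∃ μ : ProbabilityMeasure ℂ,
      CayleyIsing.IsLimitingMeasure (CayleyIsing.rootedCayleyTree k) t μ ∧
        CayleyIsing.IsLimitingMeasure (CayleyIsing.fullCayleyTree k) t μ := by
  choose! L hL hL' using fun (z : ℂ) (hz : ‖z‖ < 1) => exists_tendsto_logDeriv_div_card hk ht hz
  choose ν hν hνc using fun n => (leeYang_rootedCayleyTree k ht n).exists_circleMeasure
  choose ν' hν' hνc' using fun n => (leeYang_fullCayleyTree k ht n).exists_circleMeasure
  obtain ⟨μ, hμ, hμc⟩ := exists_tendsto_of_cauchyTransform (ν := ν) (L := L) fun z hz =>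
    (hL z hz).congr fun n => (hνc n z hz).symm
  obtain ⟨μ', hμ', hμc'⟩ := exists_tendsto_of_cauchyTransform (ν := ν') (L := L) fun z hz =>
    (hL' z hz).congr fun n => (hνc' n z hz).symm
  -- Both limits have the Cauchy transform `L` in the disk.
  have heq : μ' = μ := Subtype.ext (ext_of_cauchyTransform_eq
    (μ := (μ' : Measure (Metric.sphere (0 : ℂ) 1))) (ν := (μ : Measure (Metric.sphere (0 : ℂ) 1)))
    fun z hz => (hμc' z hz).trans (hμc z hz).symm)
  exact ⟨_, isLimitingMeasure_map hν hμ, isLimitingMeasure_map hν' (heq ▸ hμ')⟩
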